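/- Let $\Sigma_{cm}$ be the signature with constants $0, 1, \bot$, unary operation $-x$ and binary operations $x+y$, $x\cdot y$, $x/y$. For a field $F$, the common meadow $\mathsf{Enl}_\bot(F(\_/\_))$ is the $\Sigma_{cm}$-algebra with carrier $F\cup\{\bot\}$, where $\bot\notin F$, in which every operation returns $\bot$ as soon as one of its arguments is $\bot$; on arguments from $F$ the operations $-$, $+$, $\cdot$ are those of $F$, $x/y$ is the quotient in $F$ if $y\neq 0$, and $x/0=\bot$. An equation $t=t'$ between $\Sigma_{cm}$-terms with variables $x_0,x_1,x_2,\dots$ is valid in an algebra $A$ if $t$ and $t'$ have the same value in $A$ under every valuation of the variables in $A$. The fracterm calculus of common meadows is the set of all equations between $\Sigma_{cm}$-terms that are valid in every common meadow, that is, in $\mathsf{Enl}_\bot(F(\_/\_))$ for every field $F$. Theorem. The fracterm calculus of common meadows is algorithmically decidable: there is an algorithm that, given any equation $t=t'$ between $\Sigma_{cm}$-terms, determines whether it is valid in all common meadows. -/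

import Mathlib

namespace CommonMeadow

/-- Terms over the signature `0, 1, ⊥, x + y, -x, x * y, x / y` of common meadows, with variables
`x₀, x₁, x₂, …` indexed by the natural numbers. -/
inductive Term : Type
  | var (i : ℕ) : Term
  | zero : Term
  | one : Term
  | bot : Term
  | neg (t : Term) : Term
  | add (s t : Term) : Term
  | mul (s t : Term) : Term
  | div (s t : Term) : Term

/-- An equation `t = t'` over the signature is the pair `(t, t')` of its two sides. -/
abbrev Equation : Type := Term × Term

namespace Term

/-- Gödel numbering of terms: it computes the number of a term by recursion on its syntax, with the
usual pairing function on natural numbers. -/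
def encodeTerm : Term → ℕ
  | zero => 0
  | one => 1
  | bot => 2
  | var i => 5 * i + 3
  | neg t => 5 * encodeTerm t + 4
  | add s t => 5 * Nat.pair (encodeTerm s) (encodeTerm t) + 5
  | mul s t => 5 * Nat.pair (encodeTerm s) (encodeTerm t) + 6
  | div s t => 5 * Nat.pair (encodeTerm s) (encodeTerm t) + 7

/-- The term with a given Gödel number. -/
def ofNatTerm : ℕ → Term
  | 0 => zero
  | 1 => one
  | 2 => bot
  | n + 3 =>
    match n % 5 with
    | 0 => var (n / 5)
    | 1 => neg (ofNatTerm (n / 5))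
    | 2 => add (ofNatTerm (n / 5).unpair.1) (ofNatTerm (n / 5).unpair.2)
    | 3 => mul (ofNatTerm (n / 5).unpair.1) (ofNatTerm (n / 5).unpair.2)
    | _ => div (ofNatTerm (n / 5).unpair.1) (ofNatTerm (n / 5).unpair.2)
  decreasing_by
    all_goals
      have hm : n / 5 < n + 3 := lt_of_le_of_lt (Nat.div_le_self n 5) (by omega)
      first
        | exact hm
        | exact lt_of_le_of_lt (Nat.unpair_left_le _) hm
        | exact lt_of_le_of_lt (Nat.unpair_right_le _) hm

theorem ofNatTerm_encodeTerm (t : Term) : ofNatTerm (encodeTerm t) = t := by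
  induction t with
  | zero => simp [encodeTerm, ofNatTerm]
  | one => simp [encodeTerm, ofNatTerm]
  | bot => simp [encodeTerm, ofNatTerm]
  | var i =>
    simp [encodeTerm, ofNatTerm]
  | neg t ih =>
    have h1 : (5 * encodeTerm t + 1) / 5 = encodeTerm t := by omega
    have h2 : (5 * encodeTerm t + 1) % 5 = 1 := by omega
    rw [encodeTerm, ofNatTerm]
    simp only [h1, h2, ih]
  | add s t ihs iht =>
    have h1 : (5 * Nat.pair (encodeTerm s) (encodeTerm t) + 2) / 5
        = Nat.pair (encodeTerm s) (encodeTerm t) := by omega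
    have h2 : (5 * Nat.pair (encodeTerm s) (encodeTerm t) + 2) % 5 = 2 := by omega
    rw [encodeTerm, ofNatTerm]
    simp only [h1, h2, ihs, iht, Nat.unpair_pair]
  | mul s t ihs iht =>
    have h1 : (5 * Nat.pair (encodeTerm s) (encodeTerm t) + 3) / 5
        = Nat.pair (encodeTerm s) (encodeTerm t) := by omega
    have h2 : (5 * Nat.pair (encodeTerm s) (encodeTerm t) + 3) % 5 = 3 := by omega
    rw [encodeTerm, ofNatTerm]
    simp only [h1, h2, ihs, iht, Nat.unpair_pair]
  | div s t ihs iht =>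
    have h1 : (5 * Nat.pair (encodeTerm s) (encodeTerm t) + 4) / 5
        = Nat.pair (encodeTerm s) (encodeTerm t) := by omega
    have h2 : (5 * Nat.pair (encodeTerm s) (encodeTerm t) + 4) % 5 = 4 := by omega
    rw [encodeTerm, ofNatTerm]
    simp only [h1, h2, ihs, iht, Nat.unpair_pair]

theorem encodeTerm_ofNatTerm (n : ℕ) : encodeTerm (ofNatTerm n) = n := by
  induction n using Nat.strong_induction_on with
  | _ n ih =>
    match n, ih with
    | 0, _ => simp [encodeTerm, ofNatTerm]
    | 1, _ => simp [encodeTerm, ofNatTerm]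
    | 2, _ => simp [encodeTerm, ofNatTerm]
    | n + 3, ih =>
      have hm : n / 5 < n + 3 := lt_of_le_of_lt (Nat.div_le_self n 5) (by omega)
      have e0 := ih _ hm
      have e1 := ih _ (lt_of_le_of_lt (n / 5).unpair_left_le hm)
      have e2 := ih _ (lt_of_le_of_lt (n / 5).unpair_right_le hm)
      have hlt : n % 5 < 5 := Nat.mod_lt _ (by norm_num)
      have hdm := Nat.div_add_mod n 5
      rw [ofNatTerm]
      generalize n % 5 = r at hlt hdm
      interval_cases r <;> simp only [encodeTerm, e0, e1, e2, Nat.pair_unpair] <;> omega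

/-- Terms are effectively numbered, so that Mathlib's notions of computability apply to them and to
equations. -/
instance : Denumerable Term :=
  Denumerable.mk' ⟨encodeTerm, ofNatTerm, ofNatTerm_encodeTerm, encodeTerm_ofNatTerm⟩

end Term

universe u

/-- An algebra with carrier `A` over the signature of common meadows: an arbitrary interpretation of
its constants and operations. -/
structure Algebra (A : Type u) where
  zero : A
  one : A
  bot : A
  neg : A → A
  add : A → A → A
  mul : A → A → A
  div : A → A → A

namespace Algebra

/-- The value of a term in an algebra under a valuation of the variables. -/
def eval {A : Type u} (S : Algebra A) (σ : ℕ → A) : Term → A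
  | .var i => σ i
  | .zero => S.zero
  | .one => S.one
  | .bot => S.bot
  | .neg t => S.neg (eval S σ t)
  | .add s t => S.add (eval S σ s) (eval S σ t)
  | .mul s t => S.mul (eval S σ s) (eval S σ t)
  | .div s t => S.div (eval S σ s) (eval S σ t)

/-- An equation is valid in an algebra if both sides have the same value under all valuations. -/
def Valid {A : Type u} (S : Algebra A) (e : Equation) : Prop :=
  ∀ σ : ℕ → A, S.eval σ e.1 = S.eval σ e.2

end Algebra

open Classical in
/-- Division as a partial operation on a field, undefined (`none`) when the divisor is zero. -/
noncomputable def partialDiv {F : Type u} [Field F] (x y : F) : Option F :=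
  if y = 0 then none else some (x / y)

/-- The common meadow of a field `F`: its carrier is `F ∪ {⊥}`, with `⊥` represented by `none`; every
operation returns `⊥` as soon as one of its arguments is `⊥`, division returns `⊥` when the divisor
is `0`, and otherwise the operations are those of `F`. -/
noncomputable def commonMeadow (F : Type u) [Field F] : Algebra (Option F) where
  zero := some 0
  one := some 1
  bot := none
  neg x := x.bind fun a => some (-a)
  add x y := x.bind fun a => y.bind fun b => some (a + b)
  mul x y := x.bind fun a => y.bind fun b => some (a * b)
  div x y := x.bind fun a => y.bind fun b => partialDiv a b

/-- The fracterm calculus of common meadows: the set of all equations over the signature of common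
meadows that are valid in the common meadow of every field. -/
def fractermCalculus : Set Equation :=
  {e | ∀ (F : Type u) [Field F], (commonMeadow F).Valid e}

end CommonMeadow

universe v

namespace CommonMeadow

/-! Division is eliminated first. A variable may take the value `⊥`, so `xᵢ` is replaced by `x₂ᵢ /
x₂ᵢ₊₁`, which ranges over all of `F ∪ {⊥}`. Every term then becomes one fraction of integer
polynomials whose denominator vanishes exactly where the term is `⊥`
(`eval_commonMeadow_eq_partialDiv`). Two fractions `p / q` and `r / s` agree in all common meadows
iff, over every field, `q` and `s` have the same zeros and `q s (p s - r q)` vanishes everywhere. By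
a Nullstellensatz over `ℤ`, "`f = 0` implies `g = 0` over all fields" says that `g` lies in the
radical of `(f)`. Validity is thus three radical memberships (`mem_fractermCalculus_iff`).

Radical membership is decidable because it and its complement are both r.e.
(`computablePred_mem_radical`). Membership is certified by `n` and `r` with `g ^ n = f * r`, which
polynomial identity testing checks (`primrecPred_toPoly_eq_zero`). For non-membership, `ℤ` being
Jacobson gives a maximal ideal containing `f` but not `g`. Its residue field is finite, so a point
with `f = 0 ≠ g` can be found by searching through finite operation tables
(`exists_finite_field_point`, `exists_isSeparating`). -/

/-- An existential quantifier over a primitive recursive relation gives an r.e. predicate. -/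
theorem rePred_exists_of_primrec {α C : Type*} [Primcodable α] [Primcodable C]
    {R : α × C → Prop} (hR : PrimrecPred R) : REPred fun a => ∃ c, R (a, c) := by
  classical
  have hf : Primrec₂ fun (a : α) (n : ℕ) =>
      (Encodable.decode (α := C) n).bind fun c => if R (a, c) then some () else none := by
    refine Primrec.option_bind (Primrec.decode.comp Primrec.snd) ?_
    refine Primrec.ite ?_ (Primrec.const _) (Primrec.const _)
    exact hR.comp (Primrec.pair (Primrec.fst.comp Primrec.fst) Primrec.snd)
  refine (Partrec.dom_re (Partrec.rfindOpt hf.to_comp)).of_eq fun a => ?_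
  rw [Nat.rfindOpt_dom]
  constructor
  · rintro ⟨n, u, hu⟩
    simp only [Option.mem_def, Option.bind_eq_some_iff] at hu
    obtain ⟨c, -, hc⟩ := hu
    refine ⟨c, ?_⟩
    by_contra h
    simp [h] at hc
  · rintro ⟨c, hc⟩
    exact ⟨Encodable.encode c, (), by simp [hc]⟩

/-! ### Primitive recursive term formation and evaluation -/

namespace Term

theorem primrec_encodeTerm : Primrec encodeTerm := Primrec.encode

theorem primrec_of_encodeTerm {α : Type*} [Primcodable α] {f : α → Term}
    (h : Primrec fun a => encodeTerm (f a)) : Primrec f :=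
  Primrec.encode_iff.1 h

theorem primrec_var : Primrec var :=
  primrec_of_encodeTerm <| Primrec.nat_add.comp
    (Primrec.nat_mul.comp (Primrec.const 5) Primrec.id) (Primrec.const 3)

theorem primrec_neg : Primrec neg :=
  primrec_of_encodeTerm <| Primrec.nat_add.comp
    (Primrec.nat_mul.comp (Primrec.const 5) primrec_encodeTerm) (Primrec.const 4)

theorem primrec_five_mul_pair_add (k : ℕ) : Primrec fun x : Term × Term =>
    5 * Nat.pair (encodeTerm x.1) (encodeTerm x.2) + k :=
  Primrec.nat_add.comp (Primrec.nat_mul.comp (Primrec.const 5)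
    (Primrec₂.natPair.comp (primrec_encodeTerm.comp Primrec.fst)
      (primrec_encodeTerm.comp Primrec.snd))) (Primrec.const k)

theorem primrec_add : Primrec₂ add := primrec_of_encodeTerm (primrec_five_mul_pair_add 5)

theorem primrec_mul : Primrec₂ mul := primrec_of_encodeTerm (primrec_five_mul_pair_add 6)

end Term

open Term

/-- The value of a term computed from the list of values of all terms with smaller Gödel number. -/
def evalStep {α : Type*} (S : Algebra α) (σ : ℕ → α) (l : List α) : α :=
  if l.length = 0 then S.zero
  else if l.length = 1 then S.one
  else if l.length = 2 then S.bot
  else if (l.length - 3) % 5 = 0 then σ ((l.length - 3) / 5)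
  else if (l.length - 3) % 5 = 1 then S.neg (l.getD ((l.length - 3) / 5) S.zero)
  else if (l.length - 3) % 5 = 2 then
    S.add (l.getD ((l.length - 3) / 5).unpair.1 S.zero) (l.getD ((l.length - 3) / 5).unpair.2 S.zero)
  else if (l.length - 3) % 5 = 3 then
    S.mul (l.getD ((l.length - 3) / 5).unpair.1 S.zero) (l.getD ((l.length - 3) / 5).unpair.2 S.zero)
  else
    S.div (l.getD ((l.length - 3) / 5).unpair.1 S.zero) (l.getD ((l.length - 3) / 5).unpair.2 S.zero)

/-- The length of the list is the Gödel number of the term being evaluated, and subterms have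
smaller numbers; this is the step of a course-of-values recursion. -/
theorem evalStep_map_range {α : Type*} (S : Algebra α) (σ : ℕ → α) (n : ℕ) :
    evalStep S σ ((List.range n).map fun k => S.eval σ (ofNatTerm k)) =
      S.eval σ (ofNatTerm n) := by
  have hget : ∀ k < n, ((List.range n).map fun k => S.eval σ (ofNatTerm k)).getD k S.zero =
      S.eval σ (ofNatTerm k) := by
    intro k hk
    simp [List.getD_eq_getElem?_getD, hk]
  match n, hget with
  | 0, _ => simp [evalStep, ofNatTerm, Algebra.eval]
  | 1, _ => simp [evalStep, ofNatTerm, Algebra.eval]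
  | 2, _ => simp [evalStep, ofNatTerm, Algebra.eval]
  | n + 3, hget =>
    have hm : n / 5 < n + 3 := lt_of_le_of_lt (Nat.div_le_self n 5) (by omega)
    have e0 := hget _ hm
    have e1 := hget _ (lt_of_le_of_lt (n / 5).unpair_left_le hm)
    have e2 := hget _ (lt_of_le_of_lt (n / 5).unpair_right_le hm)
    have hlt : n % 5 < 5 := Nat.mod_lt _ (by norm_num)
    rw [ofNatTerm]
    simp only [evalStep, List.length_map, List.length_range, Nat.add_sub_cancel, e0, e1, e2]
    generalize n % 5 = r at hlt
    interval_cases r <;> simp [Algebra.eval]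

/-- Evaluation of terms is primitive recursive, uniformly in a parameter, when the operations of the
algebra and the valuation are. -/
theorem primrec_eval {P α : Type*} [Primcodable P] [Primcodable α]
    {S : P → Algebra α} {σ : P → ℕ → α}
    (hvar : Primrec₂ σ) (hzero : Primrec fun p => (S p).zero) (hone : Primrec fun p => (S p).one)
    (hbot : Primrec fun p => (S p).bot)
    (hneg : Primrec fun x : P × α => (S x.1).neg x.2)
    (hadd : Primrec fun x : P × α × α => (S x.1).add x.2.1 x.2.2)
    (hmul : Primrec fun x : P × α × α => (S x.1).mul x.2.1 x.2.2)
    (hdiv : Primrec fun x : P × α × α => (S x.1).div x.2.1 x.2.2) :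
    Primrec₂ fun p t => (S p).eval (σ p) t := by
  have hlen : Primrec fun x : P × List α => x.2.length := Primrec.list_length.comp Primrec.snd
  have hsub : Primrec fun x : P × List α => x.2.length - 3 :=
    Primrec.nat_sub.comp hlen (Primrec.const 3)
  have hmod : Primrec fun x : P × List α => (x.2.length - 3) % 5 :=
    Primrec.nat_mod.comp hsub (Primrec.const 5)
  have hquo : Primrec fun x : P × List α => (x.2.length - 3) / 5 :=
    Primrec.nat_div.comp hsub (Primrec.const 5)
  have hget : ∀ {f : P × List α → ℕ}, Primrec f →
      Primrec fun x : P × List α => x.2.getD (f x) (S x.1).zero := by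
    intro f hf
    simp only [List.getD_eq_getElem?_getD]
    exact Primrec.option_getD.comp (Primrec.list_getElem?.comp Primrec.snd hf)
      (hzero.comp Primrec.fst)
  have hl := hget (Primrec.fst.comp (Primrec.unpair.comp hquo))
  have hr := hget (Primrec.snd.comp (Primrec.unpair.comp hquo))
  have heq : ∀ {f : P × List α → ℕ} (k : ℕ), Primrec f → PrimrecPred fun x => f x = k :=
    fun k hf => Primrec.eq.comp hf (Primrec.const k)
  have hstep : Primrec₂ fun p l => evalStep (S p) (σ p) l := by
    refine Primrec.ite (heq 0 hlen) (hzero.comp Primrec.fst) ?_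
    refine Primrec.ite (heq 1 hlen) (hone.comp Primrec.fst) ?_
    refine Primrec.ite (heq 2 hlen) (hbot.comp Primrec.fst) ?_
    refine Primrec.ite (heq 0 hmod) (hvar.comp Primrec.fst hquo) ?_
    refine Primrec.ite (heq 1 hmod) (hneg.comp (Primrec.pair Primrec.fst (hget hquo))) ?_
    refine Primrec.ite (heq 2 hmod) (hadd.comp (Primrec.pair Primrec.fst (Primrec.pair hl hr))) ?_
    exact Primrec.ite (heq 3 hmod) (hmul.comp (Primrec.pair Primrec.fst (Primrec.pair hl hr)))
      (hdiv.comp (Primrec.pair Primrec.fst (Primrec.pair hl hr)))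
  have h : Primrec₂ fun (p : P) (n : ℕ) => (S p).eval (σ p) (ofNatTerm n) :=
    Primrec.nat_strong_rec _ (g := fun p l => some (evalStep (S p) (σ p) l))
      (Primrec.option_some.comp hstep) fun p n => by rw [evalStep_map_range]
  refine (h.comp Primrec.fst (primrec_encodeTerm.comp Primrec.snd)).of_eq fun x => ?_
  simp only [ofNatTerm_encodeTerm]

/-! ### Polynomials of terms and identity testing -/

open MvPolynomial

/-- A commutative ring as an algebra over the signature, with the value `0` for `⊥` and for every
quotient, so that the values of terms are those of polynomials. -/
def ringAlgebra (R : Type*) [CommRing R] : Algebra R where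
  zero := 0
  one := 1
  bot := 0
  neg x := -x
  add x y := x + y
  mul x y := x * y
  div _ _ := 0

/-- The integer polynomial described by a term, where `⊥` and quotients are read as `0`. -/
noncomputable def toPoly (t : Term) : MvPolynomial ℕ ℤ := (ringAlgebra _).eval X t

section toPoly

variable (i : ℕ) (s t : Term)

@[simp] theorem toPoly_var : toPoly (.var i) = X i := rfl
@[simp] theorem toPoly_zero : toPoly .zero = 0 := rfl
@[simp] theorem toPoly_one : toPoly .one = 1 := rfl
@[simp] theorem toPoly_bot : toPoly .bot = 0 := rfl
@[simp] theorem toPoly_neg : toPoly (.neg t) = -toPoly t := rfl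
@[simp] theorem toPoly_add : toPoly (.add s t) = toPoly s + toPoly t := rfl
@[simp] theorem toPoly_mul : toPoly (.mul s t) = toPoly s * toPoly t := rfl
@[simp] theorem toPoly_div : toPoly (.div s t) = 0 := rfl

end toPoly

theorem aeval_toPoly {R : Type*} [CommRing R] (a : ℕ → R) (t : Term) :
    aeval a (toPoly t) = (ringAlgebra R).eval a t := by
  induction t with
  | var i => simp [Algebra.eval]
  | zero => simp [Algebra.eval, ringAlgebra]
  | one => simp [Algebra.eval, ringAlgebra]
  | bot => simp [Algebra.eval, ringAlgebra]
  | neg t ih => simp [Algebra.eval, ih, ringAlgebra]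
  | add s t ihs iht => simp [Algebra.eval, ihs, iht, ringAlgebra]
  | mul s t ihs iht => simp [Algebra.eval, ihs, iht, ringAlgebra]
  | div s t ihs iht => simp [Algebra.eval, ringAlgebra]

/-- Lets a search for a polynomial cofactor run over terms, which are effectively numbered. -/
theorem toPoly_surjective : Function.Surjective toPoly := by
  have hnat : ∀ n : ℕ, ∃ t, toPoly t = (n : MvPolynomial ℕ ℤ) := by
    intro n
    induction n with
    | zero => exact ⟨.zero, by simp⟩
    | succ n ih =>
      obtain ⟨t, ht⟩ := ih
      exact ⟨.add t .one, by simp [ht]⟩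
  intro p
  induction p using MvPolynomial.induction_on with
  | C a =>
    obtain ⟨t, ht⟩ := hnat a.natAbs
    rcases Int.natAbs_eq a with h | h
    · exact ⟨t, by rw [ht, h]; simp⟩
    · exact ⟨.neg t, by rw [toPoly_neg, ht, h]; simp⟩
  | add p q hp hq =>
    obtain ⟨s, rfl⟩ := hp
    obtain ⟨t, rfl⟩ := hq
    exact ⟨.add s t, rfl⟩
  | mul_X p i hp =>
    obtain ⟨s, rfl⟩ := hp
    exact ⟨.mul s (.var i), rfl⟩

/-- The Gödel number is a crude but computable bound for degrees, and likewise for variable indices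
below; it fixes the size of the test grid. -/
theorem totalDegree_toPoly_le (t : Term) : (toPoly t).totalDegree ≤ t.encodeTerm := by
  induction t with
  | var i => simp [Term.encodeTerm]
  | zero => simp
  | one => simp
  | bot => simp
  | neg t ih =>
    simp only [toPoly_neg, totalDegree_neg, Term.encodeTerm]
    omega
  | add s t ihs iht =>
    have := Nat.add_le_pair s.encodeTerm t.encodeTerm
    have := totalDegree_add (toPoly s) (toPoly t)
    simp only [toPoly_add, Term.encodeTerm]
    omega
  | mul s t ihs iht =>
    have := Nat.add_le_pair s.encodeTerm t.encodeTerm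
    have := totalDegree_mul (toPoly s) (toPoly t)
    simp only [toPoly_mul, Term.encodeTerm]
    omega
  | div s t => simp

theorem lt_encodeTerm_of_mem_vars (t : Term) : ∀ i ∈ (toPoly t).vars, i < t.encodeTerm := by
  induction t with
  | var i =>
    simp only [toPoly_var, vars_X, Finset.mem_singleton, Term.encodeTerm]
    omega
  | zero => simp
  | one => simp
  | bot => simp
  | neg t ih =>
    intro i hi
    rw [toPoly_neg, vars_neg] at hi
    have := ih i hi
    simp only [Term.encodeTerm]
    omega
  | add s t ihs iht =>
    intro i hi
    have := Nat.left_le_pair s.encodeTerm t.encodeTerm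
    have := Nat.right_le_pair s.encodeTerm t.encodeTerm
    have hb : i < s.encodeTerm ∨ i < t.encodeTerm :=
      (Finset.mem_union.1 (vars_add_subset _ _ hi)).imp (ihs i) (iht i)
    simp only [Term.encodeTerm]
    omega
  | mul s t ihs iht =>
    intro i hi
    have := Nat.left_le_pair s.encodeTerm t.encodeTerm
    have := Nat.right_le_pair s.encodeTerm t.encodeTerm
    have hb : i < s.encodeTerm ∨ i < t.encodeTerm :=
      (Finset.mem_union.1 (vars_mul _ _ hi)).imp (ihs i) (iht i)
    simp only [Term.encodeTerm]
    omega
  | div s t => simp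

/-- A polynomial in `D` variables of total degree less than `D` vanishes if it does on the grid
`{0, …, D - 1}ᴰ`, whose points are listed by their base `D` digits. -/
theorem eq_zero_of_eval_digits {D : ℕ} {p : MvPolynomial ℕ ℤ} (hdeg : p.totalDegree < D)
    (hvars : ∀ i ∈ p.vars, i < D)
    (h : ∀ a < D ^ D, eval (fun i => ((a / D ^ i % D : ℕ) : ℤ)) p = 0) : p = 0 := by
  obtain ⟨q, rfl⟩ := exists_rename_eq_of_vars_subset_range p (Fin.val : Fin D → ℕ)
    Fin.val_injective fun i hi => ⟨⟨i, hvars i hi⟩, rfl⟩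
  have hq : q = 0 := by
    refine eq_zero_of_eval_zero_at_prod_finset q
      (fun _ => (Finset.range D).image (Nat.cast : ℕ → ℤ)) (fun i => ?_) fun x hx => ?_
    · rw [Finset.card_image_of_injective _ Nat.cast_injective, Finset.card_range]
      refine lt_of_le_of_lt ?_ hdeg
      rw [← degreeOf_rename_of_injective Fin.val_injective i]
      exact degreeOf_le_totalDegree _ _
    · simp only [Finset.mem_image, Finset.mem_range] at hx
      choose y hyD hy using hx
      -- The grid point `y` is the digit expansion of this number.
      have ha := h _ (finFunctionFinEquiv fun i => (⟨y i, hyD i⟩ : Fin D)).isLt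
      rw [eval_rename] at ha
      convert ha using 2
      have hx : x = fun i => ((y i : ℕ) : ℤ) := funext fun i => (hy i).symm
      rw [hx]
      congr 1
      funext i
      have := congrArg Fin.val
        (congrFun (finFunctionFinEquiv.symm_apply_apply fun i => (⟨y i, hyD i⟩ : Fin D)) i)
      simp only [Function.comp]
      exact_mod_cast this.symm
  rw [hq, map_zero]

theorem toPoly_eq_zero_iff (t : Term) : toPoly t = 0 ↔
    ∀ a < (t.encodeTerm + 1) ^ (t.encodeTerm + 1),
      (ringAlgebra ℤ).eval
        (fun i => ((a / (t.encodeTerm + 1) ^ i % (t.encodeTerm + 1) : ℕ) : ℤ)) t = 0 := by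
  constructor
  · intro h a _
    rw [← aeval_toPoly, h, map_zero]
  · intro h
    refine eq_zero_of_eval_digits (Nat.lt_succ_of_le (totalDegree_toPoly_le t))
      (fun i hi => Nat.lt_succ_of_lt (lt_encodeTerm_of_mem_vars t i hi)) fun a ha => ?_
    rw [← h a ha, ← aeval_toPoly]
    rfl

/-- The ring operations of the integers on formal differences `x.1 - x.2` of natural numbers. -/
def differenceAlgebra : Algebra (ℕ × ℕ) where
  zero := (0, 0)
  one := (1, 0)
  bot := (0, 0)
  neg x := (x.2, x.1)
  add x y := (x.1 + y.1, x.2 + y.2)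
  mul x y := (x.1 * y.1 + x.2 * y.2, x.1 * y.2 + x.2 * y.1)
  div _ _ := (0, 0)

/-- Pairs of naturals keep the evaluation within primitive recursion on `ℕ`. They are not
normalised, so a value is zero when its two components agree. -/
theorem eval_differenceAlgebra (σ : ℕ → ℕ) (t : Term) :
    (ringAlgebra ℤ).eval (fun i => (σ i : ℤ)) t =
      (differenceAlgebra.eval (fun i => (σ i, 0)) t).1 -
        (differenceAlgebra.eval (fun i => (σ i, 0)) t).2 := by
  induction t with
  | var i => simp [Algebra.eval]
  | zero => simp [Algebra.eval, ringAlgebra, differenceAlgebra]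
  | one => simp [Algebra.eval, ringAlgebra, differenceAlgebra]
  | bot => simp [Algebra.eval, ringAlgebra, differenceAlgebra]
  | neg t ih =>
    simp only [Algebra.eval, ih]
    simp [ringAlgebra, differenceAlgebra]
  | add s t ihs iht =>
    simp only [Algebra.eval, ihs, iht]
    simp only [ringAlgebra, differenceAlgebra]
    push_cast
    ring
  | mul s t ihs iht =>
    simp only [Algebra.eval, ihs, iht]
    simp only [ringAlgebra, differenceAlgebra]
    push_cast
    ring
  | div s t => simp [Algebra.eval, ringAlgebra, differenceAlgebra]

theorem primrec_pow : Primrec₂ fun m n : ℕ => m ^ n := Primrec₂.unpaired'.1 Nat.Primrec.pow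

theorem primrecPred_forall_lt {α : Type*} [Primcodable α] {b : α → ℕ} (hb : Primrec b)
    {R : ℕ × α → Prop} (hR : PrimrecPred R) : PrimrecPred fun a => ∀ x < b a, R (x, a) := by
  have h : PrimrecRel fun (L : List ℕ) (a : α) => ∀ x ∈ L, R (x, a) :=
    PrimrecRel.forall_mem_list (R := fun x a => R (x, a)) hR
  exact (h.comp (Primrec.list_range.comp hb) Primrec.id).of_eq fun a => by simp

/-- Polynomial identity testing is primitive recursive. -/
theorem primrecPred_toPoly_eq_zero : PrimrecPred fun t => toPoly t = 0 := by
  have hD : Primrec fun t : Term => t.encodeTerm + 1 := Primrec.succ.comp Term.primrec_encodeTerm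
  have heval : Primrec₂ fun (x : ℕ × ℕ) (t : Term) =>
      differenceAlgebra.eval (fun i => (x.1 / x.2 ^ i % x.2, 0)) t := by
    have h1 : ∀ {P : Type} [Primcodable P], Primrec fun x : P × (ℕ × ℕ) × ℕ × ℕ => x.2.1.1 :=
      Primrec.fst.comp (Primrec.fst.comp Primrec.snd)
    have h2 : ∀ {P : Type} [Primcodable P], Primrec fun x : P × (ℕ × ℕ) × ℕ × ℕ => x.2.1.2 :=
      Primrec.snd.comp (Primrec.fst.comp Primrec.snd)
    have h3 : ∀ {P : Type} [Primcodable P], Primrec fun x : P × (ℕ × ℕ) × ℕ × ℕ => x.2.2.1 :=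
      Primrec.fst.comp (Primrec.snd.comp Primrec.snd)
    have h4 : ∀ {P : Type} [Primcodable P], Primrec fun x : P × (ℕ × ℕ) × ℕ × ℕ => x.2.2.2 :=
      Primrec.snd.comp (Primrec.snd.comp Primrec.snd)
    refine primrec_eval (S := fun _ => differenceAlgebra) ?_ (Primrec.const _) (Primrec.const _)
      (Primrec.const _) ?_ ?_ ?_ (Primrec.const _)
    · refine Primrec.pair (Primrec.nat_mod.comp (Primrec.nat_div.comp
        (Primrec.fst.comp Primrec.fst) (primrec_pow.comp (Primrec.snd.comp Primrec.fst)
          Primrec.snd)) (Primrec.snd.comp Primrec.fst)) (Primrec.const 0)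
    · exact Primrec.pair (Primrec.snd.comp Primrec.snd) (Primrec.fst.comp Primrec.snd)
    · exact Primrec.pair (Primrec.nat_add.comp h1 h3) (Primrec.nat_add.comp h2 h4)
    · exact Primrec.pair
        (Primrec.nat_add.comp (Primrec.nat_mul.comp h1 h3) (Primrec.nat_mul.comp h2 h4))
        (Primrec.nat_add.comp (Primrec.nat_mul.comp h1 h4) (Primrec.nat_mul.comp h2 h3))
  have hval : Primrec fun y : ℕ × Term => differenceAlgebra.eval
      (fun i => (y.1 / (y.2.encodeTerm + 1) ^ i % (y.2.encodeTerm + 1), 0)) y.2 :=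
    heval.comp (Primrec.pair Primrec.fst (hD.comp Primrec.snd)) Primrec.snd
  have hR := Primrec.eq.comp (Primrec.fst.comp hval) (Primrec.snd.comp hval)
  refine (primrecPred_forall_lt (primrec_pow.comp hD hD) hR).of_eq fun t => ?_
  rw [toPoly_eq_zero_iff]
  refine forall₂_congr fun a _ => ?_
  rw [eval_differenceAlgebra, sub_eq_zero, Nat.cast_inj]

/-! ### Nullstellensatz over the integers: points over finite fields -/

theorem isJacobsonRing_int : IsJacobsonRing ℤ := by
  rw [isJacobsonRing_iff_prime_eq]
  intro P hP
  by_cases h0 : P = ⊥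
  · subst h0
    refine le_antisymm (fun x hx => ?_) Ideal.le_jacobson
    rw [Ideal.mem_bot]
    by_contra hx0
    -- A nonzero `x` in every maximal ideal would be divisible by a prime exceeding `|x|`.
    obtain ⟨p, hle, hp⟩ := Nat.exists_infinite_primes (x.natAbs + 1)
    have hmax : (Ideal.span {(p : ℤ)}).IsMaximal :=
      PrincipalIdealRing.isMaximal_of_irreducible (Nat.prime_iff_prime_int.1 hp).irreducible
    have hmem : x ∈ Ideal.span {(p : ℤ)} := (Submodule.mem_sInf.1 hx) _ ⟨bot_le, hmax⟩
    rw [Ideal.mem_span_singleton] at hmem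
    have := Nat.le_of_dvd (Int.natAbs_pos.2 hx0) (Int.natCast_dvd.1 hmem)
    omega
  · exact Ideal.jacobson_eq_self_of_isMaximal (H := hP.isMaximal h0)

/-- A field that is finitely generated as a ring is finite. -/
theorem finite_of_finiteType_int (k : Type*) [Field k] [_root_.Algebra.FiniteType ℤ k] :
    Finite k := by
  have := isJacobsonRing_int
  have hfin : Module.Finite ℤ k := finite_of_finite_type_of_isJacobsonRing ℤ k
  -- The field is integral over `ℤ`; if `ℤ` embedded in it, `ℤ` would itself be a field. So some `n
  -- ≠ 0` kills `k`, a finitely generated torsion group.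
  have hinj : ¬ Function.Injective (algebraMap ℤ k) := fun h =>
    Int.not_isField (isField_of_isIntegral_of_isField h (Field.toIsField k))
  obtain ⟨n, hn, hn0⟩ : ∃ n : ℤ, algebraMap ℤ k n = 0 ∧ n ≠ 0 := by
    have h := mt (injective_iff_map_eq_zero (algebraMap ℤ k)).2 hinj
    push Not at h
    exact h
  refine Module.finite_of_fg_torsion k fun x => ⟨⟨n, mem_nonZeroDivisors_of_ne_zero hn0⟩, ?_⟩
  change n • x = 0
  rw [_root_.Algebra.smul_def, hn, zero_mul]

/-- Non-membership in the radical of a principal ideal is witnessed by a point over a finite field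
with almost all coordinates zero. -/
theorem exists_finite_field_point {f g : MvPolynomial ℕ ℤ}
    (h : g ∉ (Ideal.span {f}).radical) :
    ∃ (k : Type) (_ : Field k) (_ : Finite k) (b : ℕ → k) (D : ℕ),
      (∀ i, D ≤ i → b i = 0) ∧ aeval b f = 0 ∧ aeval b g ≠ 0 := by
  obtain ⟨D, hD⟩ : ∃ D, ∀ i ∈ f.vars ∪ g.vars, i < D :=
    ⟨(f.vars ∪ g.vars).sup id + 1, fun i hi => Nat.lt_succ_of_le (Finset.le_sup (f := id) hi)⟩
  -- Only finitely many variables occur. Restricting to them makes the polynomial ring finitely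
  -- generated over `ℤ`, hence Jacobson with finite residue fields.
  obtain ⟨f, rfl⟩ := exists_rename_eq_of_vars_subset_range f (Fin.val : Fin D → ℕ)
    Fin.val_injective fun i hi => ⟨⟨i, hD i (Finset.mem_union_left _ hi)⟩, rfl⟩
  obtain ⟨g, rfl⟩ := exists_rename_eq_of_vars_subset_range g (Fin.val : Fin D → ℕ)
    Fin.val_injective fun i hi => ⟨⟨i, hD i (Finset.mem_union_right _ hi)⟩, rfl⟩
  have hg : g ∉ (Ideal.span {f}).radical := by
    rintro ⟨n, hn⟩
    refine h ⟨n, ?_⟩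
    rw [Ideal.mem_span_singleton] at hn ⊢
    rw [← map_pow]
    exact map_dvd _ hn
  have := isJacobsonRing_int
  -- The radical is the intersection of the maximal ideals containing `f`, so one of them omits `g`.
  rw [Ideal.radical_eq_jacobson, Ideal.jacobson, Submodule.mem_sInf] at hg
  push Not at hg
  obtain ⟨M, ⟨hfM, hM⟩, hgM⟩ := hg
  obtain ⟨k, _, φ, hφ, hf0, hg0⟩ : ∃ (k : Type) (_ : Field k) (φ : MvPolynomial (Fin D) ℤ →+* k),
      Function.Surjective φ ∧ φ f = 0 ∧ φ g ≠ 0 :=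
    ⟨_, Ideal.Quotient.field M, Ideal.Quotient.mk M, Ideal.Quotient.mk_surjective,
      Ideal.Quotient.eq_zero_iff_mem.2 (hfM (Ideal.mem_span_singleton_self f)),
      mt Ideal.Quotient.eq_zero_iff_mem.1 hgM⟩
  have key : ∀ p : MvPolynomial (Fin D) ℤ,
      aeval (fun i => if hi : i < D then φ (X ⟨i, hi⟩) else 0) (rename Fin.val p) = φ p := by
    intro p
    rw [aeval_rename]
    have : ((aeval ((fun i => if hi : i < D then φ (X ⟨i, hi⟩) else 0) ∘ Fin.val) :
        MvPolynomial (Fin D) ℤ →ₐ[ℤ] k) : MvPolynomial (Fin D) ℤ →+* k) = φ := by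
      refine ringHom_ext (fun n => by simp) fun i => ?_
      change (aeval _ : MvPolynomial (Fin D) ℤ →ₐ[ℤ] k) (X i) = _
      simp
    exact congrArg (fun ψ : MvPolynomial (Fin D) ℤ →+* k => ψ p) this
  let ψ : MvPolynomial (Fin D) ℤ →ₐ[ℤ] k := { φ with commutes' := fun n => by simp }
  have : _root_.Algebra.FiniteType ℤ k := _root_.Algebra.FiniteType.of_surjective ψ hφ
  refine ⟨k, inferInstance, finite_of_finiteType_int k,
    fun i => if hi : i < D then φ (X ⟨i, hi⟩) else 0, D, fun i hi => ?_, ?_, ?_⟩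
  · simp [Nat.not_lt.2 hi]
  · rw [key, hf0]
  · rwa [key]

/-! ### Finite rings as tables: certificates of non-membership -/

/-- Closure of `{0, …, n - 1}` under the ring operations at `x`, `y`, `z`, and the instances of the
commutative ring axioms at these elements. -/
def CommRingAxiomsAt (S : Algebra ℕ) (n x y z : ℕ) : Prop :=
  S.neg x < n ∧ S.add x y < n ∧ S.mul x y < n ∧
    S.add S.zero x = x ∧ S.mul S.one x = x ∧ S.add (S.neg x) x = S.zero ∧
    S.mul x y = S.mul y x ∧ S.add (S.add x y) z = S.add x (S.add y z) ∧
    S.mul (S.mul x y) z = S.mul x (S.mul y z) ∧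
    S.mul x (S.add y z) = S.add (S.mul x y) (S.mul x z)

/-- The operations on `ℕ` restrict to those of a nontrivial commutative ring on `{0, …, n - 1}`. -/
def IsCommRingBelow (S : Algebra ℕ) (n : ℕ) : Prop :=
  S.zero < n ∧ S.one < n ∧ S.zero ≠ S.one ∧
    ∀ x < n, ∀ y < n, ∀ z < n, CommRingAxiomsAt S n x y z

theorem IsCommRingBelow.exists_commRing {S : Algebra ℕ} {n : ℕ} (h : IsCommRingBelow S n)
    (hbot : S.bot = S.zero) (hdiv : ∀ x y, S.div x y = S.zero) {σ : ℕ → ℕ} (hσ : ∀ i, σ i < n) :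
    ∃ (R : Type) (_ : CommRing R) (a : ℕ → R) (v : R → ℕ), Function.Injective v ∧
      v 0 = S.zero ∧ v 1 = S.one ∧ (∀ x < n, ∃ r, v r = x) ∧
      (∀ r s, v (r * s) = S.mul (v r) (v s)) ∧
      ∀ t, v ((ringAlgebra R).eval a t) = S.eval σ t := by
  obtain ⟨h0, h1, -, h⟩ := h
  let _ : Zero {x // x < n} := ⟨⟨S.zero, h0⟩⟩
  let _ : One {x // x < n} := ⟨⟨S.one, h1⟩⟩
  let _ : Neg {x // x < n} := ⟨fun x => ⟨S.neg x, (h x x.2 x x.2 x x.2).1⟩⟩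
  let _ : Add {x // x < n} := ⟨fun x y => ⟨S.add x y, (h x x.2 y y.2 x x.2).2.1⟩⟩
  let _ : Mul {x // x < n} := ⟨fun x y => ⟨S.mul x y, (h x x.2 y y.2 x x.2).2.2.1⟩⟩
  let R : CommRing {x // x < n} := CommRing.ofMinimalAxioms
    (fun x y z => Subtype.ext (h x x.2 y y.2 z z.2).2.2.2.2.2.2.2.1)
    (fun x => Subtype.ext (h x x.2 x x.2 x x.2).2.2.2.1)
    (fun x => Subtype.ext (h x x.2 x x.2 x x.2).2.2.2.2.2.1)
    (fun x y z => Subtype.ext (h x x.2 y y.2 z z.2).2.2.2.2.2.2.2.2.1)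
    (fun x y => Subtype.ext (h x x.2 y y.2 x x.2).2.2.2.2.2.2.1)
    (fun x => Subtype.ext (h x x.2 x x.2 x x.2).2.2.2.2.1)
    (fun x y z => Subtype.ext (h x x.2 y y.2 z z.2).2.2.2.2.2.2.2.2.2)
  refine ⟨{x // x < n}, R, fun i => ⟨σ i, hσ i⟩, Subtype.val, Subtype.val_injective, rfl, rfl,
    fun x hx => ⟨⟨x, hx⟩, rfl⟩, fun _ _ => rfl, fun t => ?_⟩
  induction t with
  | var i => rfl
  | zero => rfl
  | one => rfl
  | bot => exact hbot.symm
  | neg t ih => exact congrArg S.neg ih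
  | add s t ihs iht => exact congrArg₂ S.add ihs iht
  | mul s t ihs iht => exact congrArg₂ S.mul ihs iht
  | div s t => exact (hdiv _ _).symm

/-- The data of a finite algebra with carrier `{0, …, n - 1}`: the triple of `n`, its zero and its
one, followed by the tables of negation, addition and multiplication. -/
abbrev Tables : Type := (ℕ × ℕ × ℕ) × List ℕ × List ℕ × List ℕ

/-- The operations read off from tables. -/
def tableAlgebra (T : Tables) : Algebra ℕ where
  zero := T.1.2.1
  one := T.1.2.2
  bot := T.1.2.1
  neg x := T.2.1.getD x 0
  add x y := T.2.2.1.getD (Nat.pair x y) 0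
  mul x y := T.2.2.2.getD (Nat.pair x y) 0
  div _ _ := T.1.2.1

/-- The valuation given by a list of values below `n`, and by `z` beyond its end. -/
def listValuation (n z : ℕ) (l : List ℕ) (i : ℕ) : ℕ := l.getD i z % n

/-- The tables `c.1` describe a nontrivial commutative ring in which, at the point with coordinates
`c.2.1`, the value of `x.1` is zero and that of `x.2` has inverse `c.2.2`. -/
def IsSeparating (x : Term × Term) (c : Tables × List ℕ × ℕ) : Prop :=
  IsCommRingBelow (tableAlgebra c.1) c.1.1.1 ∧ c.2.2 < c.1.1.1 ∧
    (tableAlgebra c.1).eval (listValuation c.1.1.1 c.1.1.2.1 c.2.1) x.1 = c.1.1.2.1 ∧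
    (tableAlgebra c.1).mul
      ((tableAlgebra c.1).eval (listValuation c.1.1.1 c.1.1.2.1 c.2.1) x.2) c.2.2 = c.1.1.2.2

/-- Soundness of certificates. If `g ^ n = f * r`, then `g` is nilpotent wherever `f` vanishes;
being also a unit there, it forces `1 = 0`. A nontrivial commutative ring is enough, so certificates
need not be checked to be fields. -/
theorem IsSeparating.notMem_radical {x : Term × Term} {c : Tables × List ℕ × ℕ}
    (h : IsSeparating x c) : toPoly x.2 ∉ (Ideal.span {toPoly x.1}).radical := by
  obtain ⟨hR, hw, h0, h1⟩ := h
  have hne := hR.2.2.1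
  obtain ⟨R, _, a, v, hv, hv0, hv1, hsurj, hmul, heval⟩ := hR.exists_commRing rfl (fun _ _ => rfl)
    (σ := listValuation c.1.1.1 c.1.1.2.1 c.2.1)
    -- The reduction modulo `n` in `listValuation` makes any list admissible; `n` is positive
    -- because the inverse lies below it.
    fun i => Nat.mod_lt _ (Nat.zero_lt_of_lt hw)
  obtain ⟨w, hw⟩ := hsurj _ hw
  rw [← heval, ← hw, ← hmul] at h1
  rw [← heval] at h0
  replace h0 := hv (h0.trans hv0.symm)
  replace h1 := hv (h1.trans hv1.symm)
  rw [← aeval_toPoly] at h0 h1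
  rintro ⟨n, hn⟩
  rw [Ideal.mem_span_singleton] at hn
  obtain ⟨r, hr⟩ := hn
  have hr := congrArg (aeval a) hr
  rw [map_pow, map_mul, h0, zero_mul] at hr
  have h10 : (1 : R) = 0 := by rw [← one_pow n, ← h1, mul_pow, hr, zero_mul]
  apply hne
  change v 0 = _ at hv0
  calc (tableAlgebra c.1).zero = v 0 := hv0.symm
    _ = v 1 := by rw [h10]
    _ = _ := hv1

theorem exists_table (n : ℕ) (f : ℕ → ℕ → ℕ) :
    ∃ l : List ℕ, ∀ x < n, ∀ y < n, l.getD (Nat.pair x y) 0 = f x y := by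
  refine ⟨(List.range (Nat.pair n n)).map fun u => f u.unpair.1 u.unpair.2, fun x hx y hy => ?_⟩
  have : Nat.pair x y < Nat.pair n n :=
    (Nat.pair_lt_pair_left y hx).trans (Nat.pair_lt_pair_right n hy)
  simp [List.getD_eq_getElem?_getD, this]

/-- Completeness of certificates: the finite field of `exists_finite_field_point` is written out as
tables. The point fits in a finite list because its coordinates vanish from `D` on. -/
theorem exists_isSeparating {x : Term × Term}
    (h : toPoly x.2 ∉ (Ideal.span {toPoly x.1}).radical) : ∃ c, IsSeparating x c := by
  obtain ⟨k, _, _, b, D, hb, h0, h1⟩ := exists_finite_field_point h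
  obtain ⟨n, ⟨e⟩⟩ := Finite.exists_equiv_fin k
  obtain ⟨v, hv, hlt, hsurj⟩ : ∃ v : k → ℕ, Function.Injective v ∧ (∀ r, v r < n) ∧
      ∀ x < n, ∃ r, v r = x :=
    ⟨fun r => e r, Fin.val_injective.comp e.injective, fun r => (e r).isLt,
      fun x hx => ⟨e.symm ⟨x, hx⟩, by simp⟩⟩
  -- `d` decodes numbers to field elements; its values outside the range of `v` play no role.
  obtain ⟨d, hd⟩ : ∃ d : ℕ → k, ∀ r, d (v r) = r :=
    ⟨Function.invFun v, Function.leftInverse_invFun hv⟩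
  obtain ⟨A, hA⟩ := exists_table n fun x y => v (d x + d y)
  obtain ⟨M, hM⟩ := exists_table n fun x y => v (d x * d y)
  let T : Tables := ((n, v 0, v 1), (List.range n).map fun x => v (-d x), A, M)
  have hneg : ∀ r, (tableAlgebra T).neg (v r) = v (-r) := by
    intro r
    simp [tableAlgebra, T, List.getD_eq_getElem?_getD, hlt, hd]
  have hadd : ∀ r s, (tableAlgebra T).add (v r) (v s) = v (r + s) := by
    intro r s
    simp only [tableAlgebra, T, hA _ (hlt r) _ (hlt s), hd]
  have hmul : ∀ r s, (tableAlgebra T).mul (v r) (v s) = v (r * s) := by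
    intro r s
    simp only [tableAlgebra, T, hM _ (hlt r) _ (hlt s), hd]
  have heval : ∀ t, (tableAlgebra T).eval
      (listValuation n (v 0) ((List.range D).map fun i => v (b i))) t =
        v ((ringAlgebra k).eval b t) := by
    intro t
    induction t with
    | var i =>
      simp only [Algebra.eval, listValuation]
      rcases lt_or_ge i D with hi | hi
      · simp [List.getD_eq_getElem?_getD, hi, Nat.mod_eq_of_lt (hlt _)]
      · simp [List.getD_eq_getElem?_getD, hi, hb i hi, Nat.mod_eq_of_lt (hlt _)]
    | zero => rfl
    | one => rfl
    | bot => rfl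
    | neg t ih => simp only [Algebra.eval, ih, hneg, ringAlgebra]
    | add s t ihs iht => simp only [Algebra.eval, ihs, iht, hadd, ringAlgebra]
    | mul s t ihs iht => simp only [Algebra.eval, ihs, iht, hmul, ringAlgebra]
    | div s t => rfl
  rw [aeval_toPoly] at h0 h1
  refine ⟨(T, (List.range D).map fun i => v (b i), v ((ringAlgebra k).eval b x.2)⁻¹),
    ⟨hlt 0, hlt 1, fun h => zero_ne_one (hv h), fun x hx y hy z hz => ?_⟩, hlt _, ?_, ?_⟩
  · obtain ⟨r, rfl⟩ := hsurj x hx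
    obtain ⟨s, rfl⟩ := hsurj y hy
    obtain ⟨t, rfl⟩ := hsurj z hz
    have hz : (tableAlgebra T).zero = v 0 := rfl
    have ho : (tableAlgebra T).one = v 1 := rfl
    have hlt' : ∀ r, v r < T.1.1 := hlt
    simp only [CommRingAxiomsAt, hz, ho, hneg, hadd, hmul, zero_add, one_mul, neg_add_cancel, hlt', mul_comm s r,
      add_assoc, mul_assoc, mul_add, and_self]
  · exact (heval _).trans (congrArg v h0)
  · refine (congrArg (fun u => (tableAlgebra T).mul u _) (heval _)).trans ?_
    rw [hmul, mul_inv_cancel₀ h1]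

/-- All quantifiers in the ring axioms are bounded by the size `n`, and the operations are table
lookups. -/
theorem primrecPred_isSeparating : PrimrecPred fun y : (Term × Term) × Tables × List ℕ × ℕ =>
    IsSeparating y.1 y.2 := by
  have get : ∀ {α : Type} [Primcodable α] {l : α → List ℕ} {i d : α → ℕ}, Primrec l → Primrec i →
      Primrec d → Primrec fun a => (l a).getD (i a) (d a) := by
    intro α _ l i d hl hi hd
    simp only [List.getD_eq_getElem?_getD]
    exact Primrec.option_getD.comp (Primrec.list_getElem?.comp hl hi) hd
  have hn : Primrec fun T : Tables => T.1.1 := Primrec.fst.comp Primrec.fst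
  have hz : Primrec fun T : Tables => T.1.2.1 :=
    Primrec.fst.comp (Primrec.snd.comp Primrec.fst)
  have ho : Primrec fun T : Tables => T.1.2.2 :=
    Primrec.snd.comp (Primrec.snd.comp Primrec.fst)
  have hneg : ∀ {α : Type} [Primcodable α] {T : α → Tables} {r : α → ℕ}, Primrec T → Primrec r →
      Primrec fun a => (tableAlgebra (T a)).neg (r a) := fun hT hr =>
    get (Primrec.fst.comp (Primrec.snd.comp hT)) hr (Primrec.const 0)
  have hadd : ∀ {α : Type} [Primcodable α] {T : α → Tables} {r s : α → ℕ}, Primrec T → Primrec r →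
      Primrec s → Primrec fun a => (tableAlgebra (T a)).add (r a) (s a) := fun hT hr hs =>
    get (Primrec.fst.comp (Primrec.snd.comp (Primrec.snd.comp hT))) (Primrec₂.natPair.comp hr hs)
      (Primrec.const 0)
  have hmul : ∀ {α : Type} [Primcodable α] {T : α → Tables} {r s : α → ℕ}, Primrec T → Primrec r →
      Primrec s → Primrec fun a => (tableAlgebra (T a)).mul (r a) (s a) := fun hT hr hs =>
    get (Primrec.snd.comp (Primrec.snd.comp (Primrec.snd.comp hT))) (Primrec₂.natPair.comp hr hs)
      (Primrec.const 0)
  have hring : PrimrecPred fun T : Tables => IsCommRingBelow (tableAlgebra T) T.1.1 := by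
    have hT : Primrec fun y : ℕ × ℕ × ℕ × Tables => y.2.2.2 :=
      Primrec.snd.comp (Primrec.snd.comp Primrec.snd)
    have hx : Primrec fun y : ℕ × ℕ × ℕ × Tables => y.2.2.1 :=
      Primrec.fst.comp (Primrec.snd.comp Primrec.snd)
    have hy : Primrec fun y : ℕ × ℕ × ℕ × Tables => y.2.1 := Primrec.fst.comp Primrec.snd
    have hw : Primrec fun y : ℕ × ℕ × ℕ × Tables => y.1 := Primrec.fst
    have hnT := hn.comp hT
    have hzT := hz.comp hT
    have hoT := ho.comp hT
    refine (Primrec.nat_lt.comp hz hn).and ((Primrec.nat_lt.comp ho hn).and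
      ((Primrec.eq.comp hz ho).not.and ?_))
    refine primrecPred_forall_lt hn (R := fun y => ∀ u < y.2.1.1, ∀ z < y.2.1.1,
      CommRingAxiomsAt (tableAlgebra y.2) y.2.1.1 y.1 u z) ?_
    refine primrecPred_forall_lt (hn.comp Primrec.snd)
      (R := fun y => ∀ z < y.2.2.1.1,
      CommRingAxiomsAt (tableAlgebra y.2.2) y.2.2.1.1 y.2.1 y.1 z) ?_
    refine primrecPred_forall_lt (hn.comp (Primrec.snd.comp Primrec.snd)) 
      (R := fun y => CommRingAxiomsAt (tableAlgebra y.2.2.2) y.2.2.2.1.1 y.2.2.1 y.2.1 y.1) ?_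
    refine (Primrec.nat_lt.comp (hneg hT hx) hnT).and <|
      (Primrec.nat_lt.comp (hadd hT hx hy) hnT).and <|
      (Primrec.nat_lt.comp (hmul hT hx hy) hnT).and <|
      (Primrec.eq.comp (hadd hT hzT hx) hx).and <|
      (Primrec.eq.comp (hmul hT hoT hx) hx).and <|
      (Primrec.eq.comp (hadd hT (hneg hT hx) hx) hzT).and <|
      (Primrec.eq.comp (hmul hT hx hy) (hmul hT hy hx)).and <|
      (Primrec.eq.comp (hadd hT (hadd hT hx hy) hw) (hadd hT hx (hadd hT hy hw))).and <|
      (Primrec.eq.comp (hmul hT (hmul hT hx hy) hw) (hmul hT hx (hmul hT hy hw))).and <|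
      (Primrec.eq.comp (hmul hT hx (hadd hT hy hw)) (hadd hT (hmul hT hx hy) (hmul hT hx hw)))
  have heval : Primrec₂ fun (p : Tables × List ℕ) (t : Term) =>
      (tableAlgebra p.1).eval (listValuation p.1.1.1 p.1.1.2.1 p.2) t := by
    have hT : ∀ {β : Type} [Primcodable β], Primrec fun y : (Tables × List ℕ) × β => y.1.1 :=
      Primrec.fst.comp Primrec.fst
    refine primrec_eval (S := fun p : Tables × List ℕ => tableAlgebra p.1) ?_ (hz.comp Primrec.fst)
      (ho.comp Primrec.fst) (hz.comp Primrec.fst) (hneg hT Primrec.snd)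
      (hadd hT (Primrec.fst.comp Primrec.snd) (Primrec.snd.comp Primrec.snd))
      (hmul hT (Primrec.fst.comp Primrec.snd) (Primrec.snd.comp Primrec.snd)) (hz.comp hT)
    exact Primrec.nat_mod.comp (get (Primrec.snd.comp Primrec.fst) Primrec.snd (hz.comp hT))
      (hn.comp hT)
  have hT : Primrec fun y : (Term × Term) × Tables × List ℕ × ℕ => y.2.1 :=
    Primrec.fst.comp Primrec.snd
  have hw : Primrec fun y : (Term × Term) × Tables × List ℕ × ℕ => y.2.2.2 :=
    Primrec.snd.comp (Primrec.snd.comp Primrec.snd)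
  have hp : Primrec fun y : (Term × Term) × Tables × List ℕ × ℕ => (y.2.1, y.2.2.1) :=
    Primrec.pair hT (Primrec.fst.comp (Primrec.snd.comp Primrec.snd))
  have hs := heval.comp hp (Primrec.fst.comp Primrec.fst)
  have ht := heval.comp hp (Primrec.snd.comp Primrec.fst)
  exact (hring.comp hT).and <| (Primrec.nat_lt.comp hw (hn.comp hT)).and <|
    (Primrec.eq.comp hs (hz.comp hT)).and <|
    (Primrec.eq.comp (hmul hT ht hw) (ho.comp hT))

/-! ### Decidability of radical membership -/

/-- The powers of a term. -/
def termPow (t : Term) (n : ℕ) : Term := n.rec .one fun _ u => .mul t u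

theorem toPoly_termPow (t : Term) (n : ℕ) : toPoly (termPow t n) = toPoly t ^ n := by
  induction n with
  | zero => simp [termPow]
  | succ n ih =>
    rw [pow_succ', ← ih]
    rfl

theorem primrec_termPow : Primrec₂ termPow :=
  Primrec.nat_rec' (f := fun x : Term × ℕ => x.2) (g := fun _ => Term.one)
    (h := fun x y => Term.mul x.1 y.2) Primrec.snd (Primrec.const _)
    (Term.primrec_mul.comp (Primrec.fst.comp Primrec.fst) (Primrec.snd.comp Primrec.snd))

theorem mem_radical_span_toPoly_iff (s t : Term) :
    toPoly t ∈ (Ideal.span {toPoly s}).radical ↔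
      ∃ c : ℕ × Term, toPoly (.add (termPow t c.1) (.neg (.mul s c.2))) = 0 := by
  simp only [toPoly_add, toPoly_neg, toPoly_mul, toPoly_termPow, ← sub_eq_add_neg, sub_eq_zero]
  constructor
  · rintro ⟨n, hn⟩
    obtain ⟨r, hr⟩ := Ideal.mem_span_singleton.1 hn
    obtain ⟨u, rfl⟩ := toPoly_surjective r
    exact ⟨(n, u), hr⟩
  · rintro ⟨c, hc⟩
    exact ⟨c.1, Ideal.mem_span_singleton.2 ⟨_, hc⟩⟩

/-- Membership in the radical of a principal ideal of integer polynomials is decidable. -/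
theorem computablePred_mem_radical : ComputablePred fun x : Term × Term =>
    toPoly x.2 ∈ (Ideal.span {toPoly x.1}).radical := by
  -- Post's theorem: the two searches, for a cofactor and for a separating point, cannot both fail.
  refine ComputablePred.computable_iff_re_compl_re'.2 ⟨?_, ?_⟩
  · have hu : Primrec fun y : (Term × Term) × ℕ × Term =>
        Term.add (termPow y.1.2 y.2.1) (.neg (.mul y.1.1 y.2.2)) :=
      Term.primrec_add.comp
        (primrec_termPow.comp (Primrec.snd.comp Primrec.fst) (Primrec.fst.comp Primrec.snd))
        (Term.primrec_neg.comp (Term.primrec_mul.comp (Primrec.fst.comp Primrec.fst)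
          (Primrec.snd.comp Primrec.snd)))
    exact (rePred_exists_of_primrec (primrecPred_toPoly_eq_zero.comp hu)).of_eq
      fun x => (mem_radical_span_toPoly_iff x.1 x.2).symm
  · exact (rePred_exists_of_primrec primrecPred_isSeparating).of_eq
      fun x => ⟨fun ⟨_, hc⟩ => hc.notMem_radical, exists_isSeparating⟩

/-- Finite fields already suffice. The one obtained lives in `Type`, and `ULift` carries it to the
universe `v` of the quantifier. -/
theorem mem_radical_of_forall_field {f g : MvPolynomial ℕ ℤ}
    (h : ∀ (F : Type v) [Field F] (a : ℕ → F), aeval a f = 0 → aeval a g = 0) :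
    g ∈ (Ideal.span {f}).radical := by
  by_contra hg
  obtain ⟨k, _, -, b, -, -, hf, hg⟩ := exists_finite_field_point hg
  let φ : k →ₐ[ℤ] ULift.{v} k := (ULift.ringEquiv (R := k)).symm.toRingHom.toIntAlgHom
  have hφ : ∀ p : MvPolynomial ℕ ℤ, aeval (fun i => φ (b i)) p = φ (aeval b p) := fun p =>
    (comp_aeval_apply b φ p).symm
  have h0 := h (ULift.{v} k) (fun i => φ (b i)) (by rw [hφ, hf, map_zero])
  rw [hφ] at h0
  exact hg (congrArg ULift.down h0)

theorem aeval_eq_zero_of_mem_radical {f g : MvPolynomial ℕ ℤ} (h : g ∈ (Ideal.span {f}).radical)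
    {F : Type*} [Field F] {a : ℕ → F} (hf : aeval a f = 0) : aeval a g = 0 := by
  obtain ⟨n, hn⟩ := h
  obtain ⟨r, hr⟩ := Ideal.mem_span_singleton.1 hn
  have := congrArg (aeval a) hr
  rw [map_pow, map_mul, hf, zero_mul] at this
  exact eq_zero_of_pow_eq_zero this

/-! ### Flattening terms to fractions -/

/-- The operations on formal fractions, with denominators that vanish where the value is `⊥`. -/
def fractionAlgebra : Algebra (Term × Term) where
  zero := (.zero, .one)
  one := (.one, .one)
  bot := (.zero, .zero)
  neg x := (.neg x.1, x.2)
  add x y := (.add (.mul x.1 y.2) (.mul y.1 x.2), .mul x.2 y.2)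
  mul x y := (.mul x.1 y.1, .mul x.2 y.2)
  div x y := (.mul x.1 (.mul y.2 y.2), .mul x.2 (.mul y.1 y.2))

/-- A term flattened to a formal fraction of division-free terms, where the variable `xᵢ`, which
may take the value `⊥`, is replaced by the fraction `x₂ᵢ / x₂ᵢ₊₁`. -/
def flatten (t : Term) : Term × Term :=
  fractionAlgebra.eval (fun i => (.var (2 * i), .var (2 * i + 1))) t

theorem primrec_flatten : Primrec flatten := by
  have hx1 : Primrec fun x : Unit × (Term × Term) × Term × Term => x.2.1.1 :=
    Primrec.fst.comp (Primrec.fst.comp Primrec.snd)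
  have hx2 : Primrec fun x : Unit × (Term × Term) × Term × Term => x.2.1.2 :=
    Primrec.snd.comp (Primrec.fst.comp Primrec.snd)
  have hy1 : Primrec fun x : Unit × (Term × Term) × Term × Term => x.2.2.1 :=
    Primrec.fst.comp (Primrec.snd.comp Primrec.snd)
  have hy2 : Primrec fun x : Unit × (Term × Term) × Term × Term => x.2.2.2 :=
    Primrec.snd.comp (Primrec.snd.comp Primrec.snd)
  have hi : Primrec fun x : Unit × ℕ => 2 * x.2 :=
    Primrec.nat_mul.comp (Primrec.const 2) Primrec.snd
  have hmul := fun {f g : Unit × (Term × Term) × Term × Term → Term} (hf : Primrec f)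
    (hg : Primrec g) => Term.primrec_mul.comp hf hg
  have h : Primrec₂ fun (_ : Unit) (t : Term) => flatten t := by
    refine primrec_eval (S := fun _ => fractionAlgebra)
      (Primrec.pair (Term.primrec_var.comp hi) (Term.primrec_var.comp (Primrec.succ.comp hi)))
      (Primrec.const _) (Primrec.const _) (Primrec.const _) ?_ ?_ ?_ ?_
    · exact Primrec.pair (Term.primrec_neg.comp (Primrec.fst.comp Primrec.snd))
        (Primrec.snd.comp Primrec.snd)
    · exact Primrec.pair (Term.primrec_add.comp (hmul hx1 hy2) (hmul hy1 hx2)) (hmul hx2 hy2)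
    · exact Primrec.pair (hmul hx1 hy1) (hmul hx2 hy2)
    · exact Primrec.pair (hmul hx1 (hmul hy2 hy2)) (hmul hx2 (hmul hy1 hy2))
  exact h.comp (Primrec.const ()) Primrec.id

section partialDiv

variable {F : Type*} [Field F] (p q r s : F)

theorem partialDiv_of_ne {q : F} (h : q ≠ 0) : partialDiv p q = some (p / q) := if_neg h

theorem partialDiv_zero : partialDiv p 0 = none := if_pos rfl

theorem neg_partialDiv :
    (commonMeadow F).neg (partialDiv p q) = partialDiv (-p) q := by
  by_cases hq : q = 0
  · simp [commonMeadow, hq, partialDiv_zero]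
  · simp [commonMeadow, partialDiv_of_ne, hq, neg_div]

theorem add_partialDiv : (commonMeadow F).add (partialDiv p q) (partialDiv r s) =
    partialDiv (p * s + r * q) (q * s) := by
  by_cases hq : q = 0
  · simp [commonMeadow, hq, partialDiv_zero]
  by_cases hs : s = 0
  · simp [commonMeadow, hs, partialDiv_zero]
  simp only [commonMeadow, partialDiv_of_ne, ne_eq, hq, hs, mul_eq_zero, or_self, not_false_eq_true,
    Option.bind_some, div_add_div p r hq hs, mul_comm r q]

theorem mul_partialDiv : (commonMeadow F).mul (partialDiv p q) (partialDiv r s) =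
    partialDiv (p * r) (q * s) := by
  by_cases hq : q = 0
  · simp [commonMeadow, hq, partialDiv_zero]
  by_cases hs : s = 0
  · simp [commonMeadow, hs, partialDiv_zero]
  simp only [commonMeadow, partialDiv_of_ne, ne_eq, hq, hs, mul_eq_zero, or_self, not_false_eq_true,
    Option.bind_some, div_mul_div_comm]

/-- The usual `(p * s) / (q * r)` would be defined at some points with `s = 0`; the extra factor `s`
above and below makes the denominator vanish there. -/
theorem div_partialDiv : (commonMeadow F).div (partialDiv p q) (partialDiv r s) =
    partialDiv (p * (s * s)) (q * (r * s)) := by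
  by_cases hq : q = 0
  · simp [commonMeadow, hq, partialDiv_zero]
  by_cases hs : s = 0
  · simp [commonMeadow, hs, partialDiv_zero]
  by_cases hr : r = 0
  · simp [commonMeadow, hr, partialDiv_zero, partialDiv_of_ne, hq, hs]
  have hrs : r / s ≠ 0 := div_ne_zero hr hs
  have hqrs : q * (r * s) ≠ 0 := mul_ne_zero hq (mul_ne_zero hr hs)
  simp only [commonMeadow, partialDiv_of_ne, ne_eq, hq, hs, hrs, hqrs, not_false_eq_true,
    Option.bind_some]
  congr 1
  field_simp

/-- The factor `q * s` switches the cross-multiplied equation off where a side is `⊥`, so the third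
condition is an unconditional polynomial identity. -/
theorem partialDiv_eq_partialDiv_iff : partialDiv p q = partialDiv r s ↔
    (q = 0 → s = 0) ∧ (s = 0 → q = 0) ∧ q * s * (p * s - r * q) = 0 := by
  by_cases hq : q = 0 <;> by_cases hs : s = 0
  · simp [hq, hs, partialDiv_zero]
  · simp [hq, hs, partialDiv_zero, partialDiv_of_ne]
  · simp [hq, hs, partialDiv_zero, partialDiv_of_ne]
  · simp [hq, hs, partialDiv_of_ne, sub_eq_zero, div_eq_div_iff]

theorem eval_commonMeadow_eq_partialDiv (a : ℕ → F) (t : Term) :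
    (commonMeadow F).eval (fun i => partialDiv (a (2 * i)) (a (2 * i + 1))) t =
      partialDiv (aeval a (toPoly (flatten t).1)) (aeval a (toPoly (flatten t).2)) := by
  induction t with
  | var i => simp [flatten, Algebra.eval]
  | zero => simp [flatten, fractionAlgebra, Algebra.eval, commonMeadow, partialDiv_of_ne]
  | one => simp [flatten, fractionAlgebra, Algebra.eval, commonMeadow, partialDiv_of_ne]
  | bot => simp [flatten, fractionAlgebra, Algebra.eval, commonMeadow, partialDiv_zero]
  | neg t ih =>
    simp only [Algebra.eval, ih, neg_partialDiv]
    simp [flatten, fractionAlgebra, Algebra.eval]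
  | add s t ihs iht =>
    simp only [Algebra.eval, ihs, iht, add_partialDiv]
    simp [flatten, fractionAlgebra, Algebra.eval]
  | mul s t ihs iht =>
    simp only [Algebra.eval, ihs, iht, mul_partialDiv]
    simp [flatten, fractionAlgebra, Algebra.eval]
  | div s t ihs iht =>
    simp only [Algebra.eval, ihs, iht, div_partialDiv]
    simp [flatten, fractionAlgebra, Algebra.eval]

theorem exists_partialDiv_eq (σ : ℕ → Option F) :
    ∃ a : ℕ → F, σ = fun i => partialDiv (a (2 * i)) (a (2 * i + 1)) := by
  -- The value `⊥` is written as `0 / 0`, and `x` in `F` as `x / 1`.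
  refine ⟨fun j => if j % 2 = 0 then (σ (j / 2)).getD 0 else (σ (j / 2)).elim 0 fun _ => 1,
    funext fun i => ?_⟩
  have h1 : (2 * i + 1) / 2 = i := by omega
  have h2 : (2 * i + 1) % 2 = 1 := by omega
  have h3 : 2 * i / 2 = i := by omega
  have h4 : 2 * i % 2 = 0 := by omega
  simp only [h1, h2, h3, h4]
  cases σ i <;> simp [partialDiv_zero, partialDiv_of_ne]

end partialDiv

/-! ### Reduction of the calculus to radical membership -/

/-- A term whose polynomial vanishes exactly where two formal fractions with nonzero denominators
have the same value. -/
def crossDifference (x y : Term × Term) : Term :=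
  .mul (.mul x.2 y.2) (.add (.mul x.1 y.2) (.neg (.mul y.1 x.2)))

/-- The ideal `(0)` in the third condition encodes an identity without premise, so that one decision
procedure serves all three. -/
theorem mem_fractermCalculus_iff (e : Equation) : e ∈ fractermCalculus.{v} ↔
    toPoly (flatten e.2).2 ∈ (Ideal.span {toPoly (flatten e.1).2}).radical ∧
    toPoly (flatten e.1).2 ∈ (Ideal.span {toPoly (flatten e.2).2}).radical ∧
    toPoly (crossDifference (flatten e.1) (flatten e.2)) ∈
      (Ideal.span {toPoly .zero}).radical := by
  have key : e ∈ fractermCalculus.{v} ↔ ∀ (F : Type v) [Field F] (a : ℕ → F),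
      (aeval a (toPoly (flatten e.1).2) = 0 → aeval a (toPoly (flatten e.2).2) = 0) ∧
      (aeval a (toPoly (flatten e.2).2) = 0 → aeval a (toPoly (flatten e.1).2) = 0) ∧
      aeval a (toPoly (crossDifference (flatten e.1) (flatten e.2))) = 0 := by
    refine forall₂_congr fun F _ => ?_
    have h : ∀ a : ℕ → F, ((commonMeadow F).eval
          (fun i => partialDiv (a (2 * i)) (a (2 * i + 1))) e.1 =
        (commonMeadow F).eval (fun i => partialDiv (a (2 * i)) (a (2 * i + 1))) e.2) ↔ _ :=
      fun a => by
        rw [eval_commonMeadow_eq_partialDiv, eval_commonMeadow_eq_partialDiv,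
          partialDiv_eq_partialDiv_iff]
    have hc : ∀ a : ℕ → F, aeval a (toPoly (crossDifference (flatten e.1) (flatten e.2))) =
        aeval a (toPoly (flatten e.1).2) * aeval a (toPoly (flatten e.2).2) *
          (aeval a (toPoly (flatten e.1).1) * aeval a (toPoly (flatten e.2).2) -
            aeval a (toPoly (flatten e.2).1) * aeval a (toPoly (flatten e.1).2)) := fun a => by
      simp [crossDifference, sub_eq_add_neg]
    simp only [hc, ← h]
    constructor
    · exact fun hv a => hv _
    · intro hv σ
      obtain ⟨a, rfl⟩ := exists_partialDiv_eq σ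
      exact hv a
  rw [key]
  constructor
  · intro h
    exact ⟨mem_radical_of_forall_field.{v} fun F _ a => (h F a).1,
      mem_radical_of_forall_field.{v} fun F _ a => (h F a).2.1,
      mem_radical_of_forall_field.{v} fun F _ a _ => (h F a).2.2⟩
  · rintro ⟨h1, h2, h3⟩ F _ a
    exact ⟨aeval_eq_zero_of_mem_radical h1, aeval_eq_zero_of_mem_radical h2,
      aeval_eq_zero_of_mem_radical h3 (by simp)⟩

theorem computablePred_mem_fractermCalculus :
    ComputablePred fun e : Equation => e ∈ fractermCalculus.{v} := by
  obtain ⟨f, hf, hrad⟩ := ComputablePred.computable_iff.1 computablePred_mem_radical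
  have hmem : ∀ x : Term × Term,
      toPoly x.2 ∈ (Ideal.span {toPoly x.1}).radical ↔ f x = true := fun x => by
    simpa using congrFun hrad x
  have hl : Primrec fun e : Equation => flatten e.1 := primrec_flatten.comp Primrec.fst
  have hr : Primrec fun e : Equation => flatten e.2 := primrec_flatten.comp Primrec.snd
  have hl2 := Primrec.snd.comp hl
  have hr2 := Primrec.snd.comp hr
  have hc : Primrec fun e : Equation => crossDifference (flatten e.1) (flatten e.2) :=
    Term.primrec_mul.comp (Term.primrec_mul.comp hl2 hr2)
      (Term.primrec_add.comp (Term.primrec_mul.comp (Primrec.fst.comp hl) hr2)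
        (Term.primrec_neg.comp (Term.primrec_mul.comp (Primrec.fst.comp hr) hl2)))
  refine ComputablePred.computable_iff.2
    ⟨fun e => f ((flatten e.1).2, (flatten e.2).2) && (f ((flatten e.2).2, (flatten e.1).2) &&
      f (.zero, crossDifference (flatten e.1) (flatten e.2))), ?_, ?_⟩
  · exact Primrec.and.to_comp.comp (hf.comp (Primrec.pair hl2 hr2).to_comp)
      (Primrec.and.to_comp.comp (hf.comp (Primrec.pair hr2 hl2).to_comp)
        (hf.comp (Primrec.pair (Primrec.const _) hc).to_comp))
  · funext e
    simp only [mem_fractermCalculus_iff, Bool.and_eq_true, ← hmem]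

end CommonMeadow

theorem theorem4p3 :
    ComputablePred fun e : CommonMeadow.Equation => e ∈ CommonMeadow.fractermCalculus.{v} := by
  exact CommonMeadow.computablePred_mem_fractermCalculus
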